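/- Let $n$ be a positive integer and $[n]=\{1,\dots,n\}$. A flag of $[n]$ is a set $f$ of non-empty proper subsets of $[n]$ such that $A\subseteq B$ or $B\subseteq A$ for all $A,B\in f$; its type is $\{|A| : A\in f\}$. For $T\subseteq[n-1]$, let $\Gamma(n,T)$ be the graph whose vertices are the flags of $[n]$ of type $T$, two flags $f,g$ being adjacent when they are in general position, i.e. $A\cap B=\emptyset$ or $A\cup B=[n]$ for all $A\in f$ and $B\in g$. Let $T=\{t_1<t_2<\dots<t_r\}\subseteq[n-1]$ with $r\ge 1$ and $\frac n2\le t_1$, and assume moreover that $t_1\neq\frac n2$ unless $n=2$. Then $$\mathrm{Aut}(\Gamma(n,T))\;\cong\; N\rtimes S_n,\qquad N=\underbrace{S_m\times\cdots\times S_m}_{\binom{n}{t_1}},$$ where $m$ is the number of flags of $[n]$ of type $T$ that contain a fixed $t_1$-subset $A$ of $[n]$ (this number is the same for every such $A$), the factors of $N$ are indexed by the $t_1$-subsets of $[n]$, and $S_n$ acts on $N$ by permuting the factors as it permutes the $t_1$-subsets of $[n]$. -/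

import Mathlib

open scoped Pointwise

namespace FlagGraph

/-- A flag of `[n]` (modelled by `Fin n`): a set of non-empty proper subsets of `[n]`, any two of
which are comparable with respect to inclusion. -/
def IsFlag {n : ℕ} (f : Finset (Finset (Fin n))) : Prop :=
  (∀ A ∈ f, A ≠ ∅ ∧ A ≠ Finset.univ) ∧ ∀ A ∈ f, ∀ B ∈ f, A ⊆ B ∨ B ⊆ A

/-- The type of a flag: the set of the cardinalities of its members. -/
def flagType {n : ℕ} (f : Finset (Finset (Fin n))) : Finset ℕ :=
  f.image Finset.card

/-- The set of all flags of `[n]` of type `T`. -/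
def flags (n : ℕ) (T : Finset ℕ) : Set (Finset (Finset (Fin n))) :=
  {f | IsFlag f ∧ flagType f = T}

/-- The set of all flags of `[n]` of type `T` that have the set `A` as a member. -/
def flagsThrough (n : ℕ) (T : Finset ℕ) (A : Finset (Fin n)) : Set (Finset (Finset (Fin n))) :=
  {f | f ∈ flags n T ∧ A ∈ f}

/-- Two flags are in general position if any member of the one and any member of the other are
disjoint or have union `[n]`. -/
def GeneralPosition {n : ℕ} (f g : Finset (Finset (Fin n))) : Prop :=
  ∀ A ∈ f, ∀ B ∈ g, A ∩ B = ∅ ∨ A ∪ B = Finset.univ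

/-- The general position graph `Γ(n,T)`. The clause `f ≠ g` only matters for the empty flag: a
non-empty flag is never in general position with itself. -/
def generalPositionGraph (n : ℕ) (T : Finset ℕ) : SimpleGraph (flags n T) where
  Adj f g := f ≠ g ∧ GeneralPosition f.1 g.1
  symm := ⟨fun f g h => ⟨h.1.symm, fun A hA B hB => by
    rw [Finset.inter_comm, Finset.union_comm]
    exact h.2 B hB A hA⟩⟩

/-- The semidirect product `N ⋊ S_n`, where `N` is the direct product of copies of `S_m` indexed by
the `t`-subsets of `[n]` and `S_n` permutes the factors of `N` as it permutes the `t`-subsets of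
`[n]`, that is, `(σ • F) A = F (σ⁻¹ A)`. -/
abbrev SubsetWreathProduct (m n t : ℕ) : Type :=
  (Set.powersetCard (Fin n) t → Equiv.Perm (Fin m)) ⋊[mulAutArrow] Equiv.Perm (Fin n)

end FlagGraph

namespace FlagGraph

open Finset

/-! Write t for `t₁`. As n ≤ 2t, disjoint t-sets already cover [n], and every member of a flag
contains its t-member; so flags are adjacent exactly when their t-members cover [n]. Hence Γ is a
blow-up, with fibres of size m, of the covering relation on t-sets (`generalPositionGraph_adj_iff`,
`exists_flags_equiv`). That relation is twin-free (`eq_of_union_eq_univ_iff`), so automorphisms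
permute the fibres, and `nonempty_blowUp_mulEquiv` gives the wreath product once the base has only
the automorphisms from S_n.

Complementation turns the base into the Kneser graph on k-sets, k = n - t. Counting common
neighbours recovers Johnson adjacency (`johnsonMap_of_disjoint_iff`); a Johnson map descends from
(k+1)-sets to k-sets, and at singletons it is a permutation of the points
(`JohnsonMap.exists_perm`). -/

theorem exists_card_mem_subset {α : Type*} {k : ℕ} {x : α} {W : Finset α} (hx : x ∈ W) (hk : 1 ≤ k)
    (hW : k ≤ #W) :
    ∃ D ⊆ W, #D = k ∧ x ∈ D := by
  obtain ⟨D, h1, h2, h3⟩ := exists_subsuperset_card_eq (singleton_subset_iff.2 hx)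
    (by rwa [card_singleton]) hW
  exact ⟨D, h2, h3, singleton_subset_iff.1 h1⟩

/-! ### Johnson graphs: descent to points -/

section Johnson

variable {α : Type*} [DecidableEq α] {k : ℕ} {φ ψ : Finset α → Finset α}

/-- `φ` restricts to an injection of the `k`-subsets, with left inverse `ψ`, that preserves
adjacency in the Johnson graph and reflects containment in the union of two adjacent sets. -/
structure JohnsonMap (k : ℕ) (φ ψ : Finset α → Finset α) : Prop where
  card : ∀ A, #A = k → #(φ A) = k
  left_inv : ∀ A, #A = k → ψ (φ A) = A
  adj : ∀ A B, #A = k → #B = k → #(A ∪ B) = k + 1 → #(φ A ∪ φ B) = k + 1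
  sub : ∀ A B C, #A = k → #B = k → #C = k → #(A ∪ B) = k + 1 → φ C ⊆ φ A ∪ φ B → C ⊆ A ∪ B

theorem exists_insert_of_card_succ {X A : Finset α} (hX : #X = k) (hA : #A = k + 1) (h : X ⊆ A) :
    ∃ a ∉ X, A = insert a X := by
  obtain ⟨a, ha, rfl⟩ := (covBy_iff_exists_insert.1
    (Finset.covBy_iff_card_sdiff_eq_one.2 ⟨h, by rw [card_sdiff_of_subset h]; omega⟩))
  exact ⟨a, ha, rfl⟩

theorem card_union_of_common_subset {X A B : Finset α} (hX : #X = k) (hA : #A = k + 1)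
    (hB : #B = k + 1) (hXA : X ⊆ A) (hXB : X ⊆ B) (hAB : A ≠ B) :
    A ∩ B = X ∧ #(A ∪ B) = k + 2 := by
  have h1 : X ⊆ A ∩ B := subset_inter hXA hXB
  have h2 := card_union_add_card_inter A B
  have h3 : #(A ∩ B) ≤ k := by
    by_contra h
    have h4 : A ∩ B = A := eq_of_subset_of_card_le inter_subset_left (by omega)
    exact hAB (eq_of_subset_of_card_le (inter_eq_left.1 h4) (by omega))
  have h4 := card_le_card h1
  exact ⟨(eq_of_subset_of_card_le h1 (by omega)).symm, by omega⟩

/-- A point c of C outside A ∪ B forces A ∩ C and B ∩ C both to be C without c, which by size is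
then A ∩ B. -/
theorem inter_subset_of_adjacent {A B C : Finset α} (hA : #A = k) (hB : #B = k) (hC : #C = k)
    (hAB : #(A ∪ B) = k + 1) (hAC : #(A ∪ C) = k + 1) (hBC : #(B ∪ C) = k + 1)
    (hn : ¬ C ⊆ A ∪ B) : A ∩ B ⊆ C := by
  obtain ⟨c, hc, hcn⟩ := not_subset.1 hn
  simp only [mem_union, not_or] at hcn
  have e1 := card_union_add_card_inter A B
  have e2 := card_union_add_card_inter A C
  have e3 := card_union_add_card_inter B C
  have s2 : A ∩ C = C.erase c := eq_of_subset_of_card_le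
    (fun x hx => mem_erase.2 ⟨fun h => hcn.1 (h ▸ (mem_inter.1 hx).1), (mem_inter.1 hx).2⟩)
    (by rw [card_erase_of_mem hc]; omega)
  have s3 : B ∩ C = C.erase c := eq_of_subset_of_card_le
    (fun x hx => mem_erase.2 ⟨fun h => hcn.2 (h ▸ (mem_inter.1 hx).1), (mem_inter.1 hx).2⟩)
    (by rw [card_erase_of_mem hc]; omega)
  have s : C.erase c ⊆ A ∩ B := subset_inter (s2 ▸ inter_subset_left) (s3 ▸ inter_subset_left)
  have s' : C.erase c = A ∩ B := eq_of_subset_of_card_le s (by rw [card_erase_of_mem hc]; omega)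
  exact s' ▸ erase_subset c C

theorem JohnsonMap.ne (h : JohnsonMap k φ ψ) {A B : Finset α} (hA : #A = k) (hB : #B = k)
    (hAB : A ≠ B) : φ A ≠ φ B := fun e => hAB (by rw [← h.left_inv A hA, e, h.left_inv B hB])

variable [Fintype α]

/-- The map induced on smaller sets by a map on `k`-subsets: intersect the images of all
`k`-subsets that contain `X`. -/
def descend (k : ℕ) (φ : Finset α → Finset α) (X : Finset α) : Finset α :=
  univ.filter fun y => ∀ A, #A = k → X ⊆ A → y ∈ φ A

theorem descend_subset {X A : Finset α} (hA : #A = k) (h : X ⊆ A) : descend k φ X ⊆ φ A := by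
  intro y hy
  exact (mem_filter.1 hy).2 A hA h

/-- The images of the sets above X are pairwise adjacent. A third image inside φ A ∪ φ B would give
C ⊆ A ∪ B, putting the extra point of C into A ∪ B and hence C = A or C = B; so it contains φ A ∩ φ
B. -/
theorem JohnsonMap.descend_eq (h : JohnsonMap (k + 1) φ ψ) {X A B : Finset α} (hX : #X = k)
    (hA : #A = k + 1) (hB : #B = k + 1) (hXA : X ⊆ A) (hXB : X ⊆ B) (hAB : A ≠ B) :
    descend (k + 1) φ X = φ A ∩ φ B := by
  refine (subset_inter (descend_subset hA hXA) (descend_subset hB hXB)).antisymm ?_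
  intro y hy
  refine mem_filter.2 ⟨mem_univ y, fun C hC hXC => ?_⟩
  by_cases hCA : C = A
  · exact hCA ▸ (mem_inter.1 hy).1
  by_cases hCB : C = B
  · exact hCB ▸ (mem_inter.1 hy).2
  have u1 := (card_union_of_common_subset hX hA hB hXA hXB hAB).2
  have u2 := card_union_of_common_subset hX hA hC hXA hXC (Ne.symm hCA)
  have u3 := card_union_of_common_subset hX hB hC hXB hXC (Ne.symm hCB)
  refine inter_subset_of_adjacent (h.card A hA) (h.card B hB) (h.card C hC) (h.adj A B hA hB u1)
    (h.adj A C hA hC u2.2) (h.adj B C hB hC u3.2) (fun hs => ?_) hy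
  have hs' := h.sub A B C hA hB hC u1 hs
  obtain ⟨c, hc, rfl⟩ := exists_insert_of_card_succ hX hC hXC
  rcases mem_union.1 (hs' (mem_insert_self c X)) with hcA | hcB
  · exact hc (u2.1 ▸ mem_inter.2 ⟨hcA, mem_insert_self c X⟩)
  · exact hc (u3.1 ▸ mem_inter.2 ⟨hcB, mem_insert_self c X⟩)

theorem exists_two_supersets (hk : k + 2 ≤ Fintype.card α) {X : Finset α} (hX : #X = k) :
    ∃ A B, #A = k + 1 ∧ #B = k + 1 ∧ X ⊆ A ∧ X ⊆ B ∧ A ≠ B := by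
  obtain ⟨a, ha, b, hb, hab⟩ := one_lt_card.1 (show 1 < #Xᶜ by rw [card_compl]; omega)
  rw [mem_compl] at ha hb
  refine ⟨insert a X, insert b X, by rw [card_insert_of_notMem ha, hX],
    by rw [card_insert_of_notMem hb, hX], subset_insert _ _, subset_insert _ _, fun e => ?_⟩
  have : a ∈ insert b X := e ▸ mem_insert_self a X
  rcases mem_insert.1 this with h | h
  exacts [hab h, ha h]

theorem JohnsonMap.card_descend (h : JohnsonMap (k + 1) φ ψ) (hk : k + 2 ≤ Fintype.card α)
    {X : Finset α} (hX : #X = k) : #(descend (k + 1) φ X) = k := by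
  obtain ⟨A, B, hA, hB, hXA, hXB, hAB⟩ := exists_two_supersets hk hX
  rw [h.descend_eq hX hA hB hXA hXB hAB]
  have u := h.adj A B hA hB (card_union_of_common_subset hX hA hB hXA hXB hAB).2
  have e := card_union_add_card_inter (φ A) (φ B)
  rw [h.card A hA, h.card B hB] at e
  omega

theorem JohnsonMap.descend_left_inv (h : JohnsonMap (k + 1) φ ψ) (h' : JohnsonMap (k + 1) ψ φ)
    (hk : k + 2 ≤ Fintype.card α) {X : Finset α} (hX : #X = k) :
    descend (k + 1) ψ (descend (k + 1) φ X) = X := by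
  obtain ⟨A, B, hA, hB, hXA, hXB, hAB⟩ := exists_two_supersets hk hX
  rw [h'.descend_eq (h.card_descend hk hX) (h.card A hA) (h.card B hB) (descend_subset hA hXA)
    (descend_subset hB hXB) (h.ne hA hB hAB), h.left_inv A hA, h.left_inv B hB]
  exact (card_union_of_common_subset hX hA hB hXA hXB hAB).1

/-- For adjacent k-sets A and B, the union is a (k+1)-set whose image contains both descended sets;
this bounds their union and, pulled back by ψ, yields `sub`. -/
theorem JohnsonMap.descend (h : JohnsonMap (k + 1) φ ψ) (h' : JohnsonMap (k + 1) ψ φ)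
    (hk : k + 2 ≤ Fintype.card α) :
    JohnsonMap k (descend (k + 1) φ) (FlagGraph.descend (k + 1) ψ) where
  card A hA := h.card_descend hk hA
  left_inv A hA := h.descend_left_inv h' hk hA
  adj A B hA hB hAB := by
    have hne : FlagGraph.descend (k + 1) φ A ≠ FlagGraph.descend (k + 1) φ B := by
      intro e
      have : A = B := by
        rw [← h.descend_left_inv h' hk hA, e, h.descend_left_inv h' hk hB]
      rw [this, union_self] at hAB
      omega
    have h1 := h.card_descend hk hA
    have h2 := h.card_descend hk hB
    have h3 : #(FlagGraph.descend (k + 1) φ A ∪ FlagGraph.descend (k + 1) φ B) ≤ k + 1 :=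
      (card_le_card (union_subset (descend_subset hAB subset_union_left)
        (descend_subset hAB subset_union_right))).trans_eq (h.card _ hAB)
    by_contra h4
    have h5 := eq_of_subset_of_card_le (subset_union_left (s₁ := FlagGraph.descend (k + 1) φ A)
      (s₂ := FlagGraph.descend (k + 1) φ B)) (by omega)
    exact hne (eq_of_subset_of_card_le (h5 ▸ subset_union_right) (by omega)).symm
  sub A B C hA hB hC hAB hs := by
    have h1 : FlagGraph.descend (k + 1) φ C ⊆ φ (A ∪ B) :=
      hs.trans (union_subset (descend_subset hAB subset_union_left)
        (descend_subset hAB subset_union_right))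
    have h2 := descend_subset (φ := ψ) (h.card _ hAB) h1
    rwa [h.left_inv _ hAB, h.descend_left_inv h' hk hC] at h2

theorem exists_perm_of_card_one (h : ∀ A : Finset α, #A = 1 → #(φ A) = 1)
    (hi : ∀ A : Finset α, #A = 1 → ψ (φ A) = A) :
    ∃ σ : Equiv.Perm α, ∀ A : Finset α, #A = 1 → φ A = σ • A := by
  choose s hs using fun x : α => card_eq_one.1 (h {x} (card_singleton x))
  have hinj : Function.Injective s := fun x y e => by
    have := hi {x} (card_singleton x)
    rw [hs, e, ← hs, hi {y} (card_singleton y)] at this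
    exact (singleton_injective this).symm
  refine ⟨Equiv.ofBijective s (Finite.injective_iff_bijective.1 hinj), fun A hA => ?_⟩
  obtain ⟨x, rfl⟩ := card_eq_one.1 hA
  rw [hs, smul_finset_singleton]
  rfl

/-- Every automorphism of the Johnson graph on `k`-subsets that respects the triples contained in
a `(k + 1)`-subset comes from a permutation of the points. -/
theorem JohnsonMap.exists_perm (hk : 1 ≤ k) (hkn : k < Fintype.card α) :
    ∀ {φ ψ : Finset α → Finset α}, JohnsonMap k φ ψ → JohnsonMap k ψ φ →
      ∃ σ : Equiv.Perm α, ∀ A, #A = k → φ A = σ • A := by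
  induction k, hk using Nat.le_induction with
  | base => exact fun h _ => exists_perm_of_card_one h.card h.left_inv
  | succ k hk ih =>
    intro φ ψ h h'
    obtain ⟨σ, hσ⟩ := ih (by omega) (h.descend h' (by omega)) (h'.descend h (by omega))
    refine ⟨σ, fun A hA => (eq_of_subset_of_card_le ?_ ?_).symm⟩
    · intro y hy
      obtain ⟨x, hx, rfl⟩ := mem_smul_finset.1 hy
      -- Each x ∈ A lies in a k-subset of A, where the induction hypothesis applies.
      obtain ⟨z, hz, hzx⟩ := exists_mem_ne (by omega : 1 < #A) x
      have hc : #(A.erase z) = k := by rw [card_erase_of_mem hz, hA]; rfl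
      apply descend_subset (φ := φ) hA (erase_subset z A)
      rw [hσ _ hc]
      exact smul_mem_smul_finset (mem_erase.2 ⟨hzx.symm, hx⟩)
    · rw [h.card A hA, card_smul_finset, hA]

end Johnson

/-! ### Kneser graphs and the covering relation -/

section Kneser

variable {α : Type*} [Fintype α] [DecidableEq α] {k : ℕ} {φ ψ : Finset α → Finset α}

theorem card_common_neighbours (A B : Finset α) :
    #{D | #D = k ∧ Disjoint A D ∧ Disjoint B D} = (Fintype.card α - #(A ∪ B)).choose k := by
  rw [← card_compl, ← card_powersetCard]
  congr 1
  ext D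
  simp only [mem_filter, mem_univ, true_and, mem_powersetCard, ← disjoint_union_left,
    subset_compl_iff_disjoint_left]
  tauto

/-- The number of common neighbours determines whether the union has size k + 1, and a point of C
outside A ∪ B lies in a k-set disjoint from A and B but not from C. -/
theorem johnsonMap_of_disjoint_iff (hk : 1 ≤ k) (hkn : 2 * k < Fintype.card α)
    (hφ : ∀ A, #A = k → #(φ A) = k) (hψ : ∀ A, #A = k → #(ψ A) = k)
    (hψφ : ∀ A, #A = k → ψ (φ A) = A) (hφψ : ∀ A, #A = k → φ (ψ A) = A)
    (hd : ∀ A B, #A = k → #B = k → (Disjoint (φ A) (φ B) ↔ Disjoint A B)) :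
    JohnsonMap k φ ψ where
  card := hφ
  left_inv := hψφ
  adj A B hA hB hAB := by
    have hc : #{D | #D = k ∧ Disjoint A D ∧ Disjoint B D} =
        #{D | #D = k ∧ Disjoint (φ A) D ∧ Disjoint (φ B) D} := by
      refine card_nbij' φ ψ ?_ ?_ ?_ ?_
      · intro D hD
        simp only [coe_filter, mem_univ, true_and, Set.mem_ofPred_eq] at hD ⊢
        exact ⟨hφ D hD.1, (hd A D hA hD.1).2 hD.2.1, (hd B D hB hD.1).2 hD.2.2⟩
      · intro D hD
        simp only [coe_filter, mem_univ, true_and, Set.mem_ofPred_eq] at hD ⊢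
        refine ⟨hψ D hD.1, (hd A _ hA (hψ D hD.1)).1 ?_, (hd B _ hB (hψ D hD.1)).1 ?_⟩ <;>
          rw [hφψ D hD.1]
        exacts [hD.2.1, hD.2.2]
      · intro D hD
        simp only [coe_filter, mem_univ, true_and, Set.mem_ofPred_eq] at hD
        exact hψφ D hD.1
      · intro D hD
        simp only [coe_filter, mem_univ, true_and, Set.mem_ofPred_eq] at hD
        exact hφψ D hD.1
    rw [card_common_neighbours, card_common_neighbours, hAB] at hc
    have h1 : k + 1 ≤ #(φ A ∪ φ B) := by
      by_contra h2
      have h3 := eq_of_subset_of_card_le (subset_union_left (s₁ := φ A) (s₂ := φ B))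
        (by rw [hφ A hA]; omega)
      have h4 : φ B = φ A := eq_of_subset_of_card_le (h3 ▸ subset_union_right)
        (by rw [hφ A hA, hφ B hB])
      have h5 : A = B := by rw [← hψφ A hA, ← h4, hψφ B hB]
      rw [h5, union_self] at hAB
      omega
    by_contra h2
    -- The image union now has at least k + 2 points; by Pascal's rule this loses a positive number
    -- of common neighbours.
    obtain ⟨j, rfl⟩ : ∃ j, k = j + 1 := ⟨k - 1, by omega⟩
    have h3 : (Fintype.card α - #(φ A ∪ φ B)).choose (j + 1) ≤
        (Fintype.card α - (j + 1 + 1) - 1).choose (j + 1) := Nat.choose_le_choose _ (by omega)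
    obtain ⟨a, ha⟩ : ∃ a, Fintype.card α - (j + 1 + 1) = a + 1 :=
      ⟨Fintype.card α - (j + 1 + 1) - 1, by omega⟩
    rw [← hc, ha, Nat.add_sub_cancel, Nat.choose_succ_succ'] at h3
    have h4 := Nat.choose_pos (show j ≤ a by omega)
    omega
  sub A B C hA hB hC hAB hs := by
    intro c hc
    by_contra hn
    obtain ⟨D, hD, hDk, hcD⟩ := exists_card_mem_subset (mem_compl.2 hn) hk
      (by rw [card_compl]; omega)
    rw [subset_compl_iff_disjoint_left, disjoint_union_left] at hD
    have h1 : Disjoint (φ A ∪ φ B) (φ D) := disjoint_union_left.2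
      ⟨(hd A D hA hDk).2 hD.1, (hd B D hB hDk).2 hD.2⟩
    exact disjoint_left.1 ((hd C D hC hDk).1 (h1.mono_left hs)) hc hcD

/-- The automorphisms of a Kneser graph are induced by permutations of the points. -/
theorem exists_perm_of_disjoint_iff (hk : 1 ≤ k) (hkn : 2 * k < Fintype.card α ∨ k = 1)
    (hφ : ∀ A, #A = k → #(φ A) = k) (hψ : ∀ A, #A = k → #(ψ A) = k)
    (hψφ : ∀ A, #A = k → ψ (φ A) = A) (hφψ : ∀ A, #A = k → φ (ψ A) = A)
    (hd : ∀ A B, #A = k → #B = k → (Disjoint (φ A) (φ B) ↔ Disjoint A B)) :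
    ∃ σ : Equiv.Perm α, ∀ A, #A = k → φ A = σ • A := by
  rcases hkn with hkn | rfl
  · refine JohnsonMap.exists_perm hk (by omega)
      (johnsonMap_of_disjoint_iff hk hkn hφ hψ hψφ hφψ hd)
      (johnsonMap_of_disjoint_iff hk hkn hψ hφ hφψ hψφ fun A B hA hB => ?_)
    rw [← hd _ _ (hψ A hA) (hψ B hB), hφψ A hA, hφψ B hB]
  · exact exists_perm_of_card_one hφ hψφ

/-- The extension of a self-map of the `t`-subsets to all sets, conjugated by complementation. -/
def complExtend {t : ℕ} (e : Set.powersetCard α t → Set.powersetCard α t) (A : Finset α) :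
    Finset α :=
  if h : #Aᶜ = t then (e (Set.powersetCard.ofCard h) : Finset α)ᶜ else ∅

theorem complExtend_compl {t : ℕ} (e : Set.powersetCard α t → Set.powersetCard α t)
    (A : Set.powersetCard α t) : complExtend e (A : Finset α)ᶜ = (e A : Finset α)ᶜ := by
  have h : #((A : Finset α)ᶜᶜ) = t := by rw [compl_compl]; exact (Set.powersetCard.card_eq A)
  rw [complExtend, dif_pos h]
  congr 3
  exact Subtype.ext (compl_compl _)

/-- Sets cover exactly when their complements are disjoint; the two cases of `h` become 2k < n and k
= 1. -/
theorem exists_perm_of_union_eq_univ_iff {t : ℕ} (ht : t < Fintype.card α)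
    (h : Fintype.card α < 2 * t ∨ t + 1 = Fintype.card α) (e : Equiv.Perm (Set.powersetCard α t))
    (he : ∀ A B, ((e A : Finset α) ∪ e B = univ ↔ (A : Finset α) ∪ B = univ)) :
    ∃ σ : Equiv.Perm α, ∀ A, e A = σ • A := by
  obtain ⟨k, hk⟩ : ∃ k, t + k = Fintype.card α := ⟨Fintype.card α - t, by omega⟩
  have key : ∀ A : Finset α, #A = k → ∃ B : Set.powersetCard α t, A = (B : Finset α)ᶜ :=
    fun A hA => ⟨Set.powersetCard.ofCard (s := Aᶜ) (by rw [card_compl]; omega), (compl_compl A).symm⟩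
  have hc : ∀ B : Set.powersetCard α t, #((B : Finset α)ᶜ) = k := fun B => by
    rw [card_compl, (Set.powersetCard.card_eq B)]; omega
  suffices H : ∃ σ : Equiv.Perm α, ∀ A, #A = k → complExtend e A = σ • A by
    obtain ⟨σ, hσ⟩ := H
    refine ⟨σ, fun A => Subtype.ext ?_⟩
    have := hσ _ (hc A)
    have hs : σ • (A : Finset α)ᶜ = (σ • (A : Finset α))ᶜ := by
      rw [← coe_inj, coe_smul_finset, coe_compl, coe_compl, coe_smul_finset, Set.smul_set_compl]
    rw [complExtend_compl, hs] at this
    exact compl_injective this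
  refine exists_perm_of_disjoint_iff (ψ := complExtend e.symm) (by omega) (by omega) ?_ ?_ ?_ ?_ ?_
  · intro X hX
    obtain ⟨A, rfl⟩ := key X hX
    rw [complExtend_compl, hc]
  · intro X hX
    obtain ⟨A, rfl⟩ := key X hX
    rw [complExtend_compl, hc]
  · intro X hX
    obtain ⟨A, rfl⟩ := key X hX
    rw [complExtend_compl, complExtend_compl, e.symm_apply_apply]
  · intro X hX
    obtain ⟨A, rfl⟩ := key X hX
    rw [complExtend_compl, complExtend_compl, e.apply_symm_apply]
  · intro A B hA hB
    obtain ⟨A, rfl⟩ := key A hA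
    obtain ⟨B, rfl⟩ := key B hB
    rw [complExtend_compl, complExtend_compl]
    have hd : ∀ X Y : Finset α, Disjoint Xᶜ Yᶜ ↔ X ∪ Y = univ := fun X Y => by
      rw [disjoint_iff_inter_eq_empty, ← compl_union, compl_eq_empty_iff]
    rw [hd, hd, he]

/-- Distinct `t`-subsets are told apart by the `t`-subsets that complete them to everything. -/
theorem eq_of_union_eq_univ_iff {t : ℕ} (h : Fintype.card α ≤ 2 * t) (ht : t < Fintype.card α)
    {A B : Set.powersetCard α t}
    (he : ∀ C : Set.powersetCard α t,
      ((A : Finset α) ∪ C = univ ↔ (B : Finset α) ∪ C = univ)) : A = B := by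
  refine Set.powersetCard.eq_iff_subset.2 fun x hxA => ?_
  by_contra hxB
  have hA := (Set.powersetCard.card_eq A)
  -- C completes A but misses x; the size t fits since n - t ≤ t ≤ n - 1.
  obtain ⟨C, h1, h2, h3⟩ := exists_subsuperset_card_eq (n := t)
    (s := (A : Finset α)ᶜ) (t := univ.erase x)
    (fun y hy => mem_erase.2 ⟨fun e => mem_compl.1 hy (e ▸ hxA), mem_univ y⟩)
    (by rw [card_compl]; omega) (by rw [card_erase_of_mem (mem_univ x), card_univ]; omega)
  have h4 : (A : Finset α) ∪ C = univ := by
    refine eq_univ_of_forall fun y => mem_union.2 ?_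
    by_cases hy : y ∈ (A : Finset α)
    exacts [.inl hy, .inr (h1 (mem_compl.2 hy))]
  have h5 : x ∈ (B : Finset α) ∪ C := (he (Set.powersetCard.ofCard h3)).1 h4 ▸ mem_univ x
  rcases mem_union.1 h5 with h6 | h6
  exacts [hxB h6, (mem_erase.1 (h2 h6)).1 rfl]

end Kneser

/-! ### Automorphisms of blow-ups -/

section BlowUp

variable {G P M V : Type*} [Group G] [MulAction G P]

/-- The imprimitive action of an unrestricted wreath product on `P × M`. -/
def wreathPerm : ((P → Equiv.Perm M) ⋊[mulAutArrow] G) →* Equiv.Perm (P × M) where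
  toFun x :=
    -- The fibre permutation is indexed by the target fibre, matching the action of `mulAutArrow`.
    { toFun := fun a => (x.right • a.1, x.left (x.right • a.1) a.2)
      invFun := fun a => (x.right⁻¹ • a.1, (x.left a.1).symm a.2)
      left_inv := fun a => by simp
      right_inv := fun a => by simp }
  map_one' := by ext a <;> simp
  map_mul' x y := by
    ext a
    · simp [mul_smul]
    · change x.left ((x.right * y.right) • a.1)
        (y.left (x.right⁻¹ • (x.right * y.right) • a.1) a.2) = _
      rw [mul_smul, inv_smul_smul]
      rfl

theorem wreathPerm_apply (x : (P → Equiv.Perm M) ⋊[mulAutArrow] G) (a : P × M) :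
    wreathPerm x a = (x.right • a.1, x.left (x.right • a.1) a.2) := rfl

theorem wreathPerm_injective [FaithfulSMul G P] [Nonempty M] :
    Function.Injective (wreathPerm (G := G) (P := P) (M := M)) := by
  intro x y h
  have h1 : ∀ p i, x.right • p = y.right • p ∧
      x.left (x.right • p) i = y.left (y.right • p) i := fun p i => by
    have := DFunLike.congr_fun h (p, i)
    simpa only [wreathPerm_apply, Prod.mk.injEq] using this
  have h2 : x.right = y.right :=
    FaithfulSMul.eq_of_smul_eq_smul (α := P) fun p => (h1 p (Classical.arbitrary M)).1
  refine SemidirectProduct.ext (funext fun p => Equiv.ext fun i => ?_) h2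
  have := (h1 (x.right⁻¹ • p) i).2
  rwa [← h2, smul_inv_smul] at this

variable {R : P → P → Prop} {Γ : SimpleGraph V} (c : V ≃ P × M)

/-- The action of the wreath product by automorphisms of a blow-up of an invariant relation. -/
def wreathIso (hadj : ∀ v w, Γ.Adj v w ↔ R (c v).1 (c w).1)
    (hR : ∀ (g : G) p q, R (g • p) (g • q) ↔ R p q) :
    ((P → Equiv.Perm M) ⋊[mulAutArrow] G) →* (Γ ≃g Γ) where
  toFun x :=
    { toEquiv := c.symm.permCongr (wreathPerm x)
      map_rel_iff' := by
        intro v w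
        simp [hadj, Equiv.permCongr_apply, wreathPerm_apply, hR] }
  map_one' := by
    ext v
    simp [Equiv.permCongr_apply]
  map_mul' x y := by
    ext v
    simp [Equiv.permCongr_apply]

/-- Vertices in one fibre have the same neighbours, hence so do their images, and twin-freeness puts
these in one fibre. -/
theorem fst_apply_eq_of_fst_eq (hadj : ∀ v w, Γ.Adj v w ↔ R (c v).1 (c w).1)
    (htwin : ∀ p q, (∀ r, R p r ↔ R q r) → p = q) [Nonempty M] (f : Γ ≃g Γ) {v w : V}
    (h : (c v).1 = (c w).1) : (c (f v)).1 = (c (f w)).1 := by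
  refine htwin _ _ fun r => ?_
  obtain ⟨u, hu⟩ : ∃ u, (c (f u)).1 = r :=
    ⟨f.symm (c.symm (r, Classical.arbitrary M)), by simp⟩
  rw [← hu, ← hadj, ← hadj, f.map_adj_iff, f.map_adj_iff, hadj, hadj, h]

/-- The automorphism group of a blow-up of a twin-free relation whose automorphisms are exactly
those in the faithful action of `G`. -/
theorem nonempty_blowUp_mulEquiv [FaithfulSMul G P] [Nonempty M]
    (hadj : ∀ v w, Γ.Adj v w ↔ R (c v).1 (c w).1)
    (hR : ∀ (g : G) p q, R (g • p) (g • q) ↔ R p q)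
    (htwin : ∀ p q, (∀ r, R p r ↔ R q r) → p = q)
    (hAut : ∀ e : Equiv.Perm P, (∀ p q, R (e p) (e q) ↔ R p q) → ∃ g : G, ∀ p, e p = g • p) :
    Nonempty ((Γ ≃g Γ) ≃* ((P → Equiv.Perm M) ⋊[mulAutArrow] G)) := by
  refine ⟨(MulEquiv.ofBijective (wreathIso c hadj hR) ⟨fun x y h => ?_, fun f => ?_⟩).symm⟩
  · apply wreathPerm_injective
    apply c.symm.permCongr.injective
    exact congrArg RelIso.toEquiv h
  · let i₀ := Classical.arbitrary M
    have hf := fun v w => fst_apply_eq_of_fst_eq c hadj htwin f (v := v) (w := w)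
    have hf' := fun v w => fst_apply_eq_of_fst_eq c hadj htwin f.symm (v := v) (w := w)
    -- Fibres go to fibres, so the choice of `i₀` is immaterial.
    let e : Equiv.Perm P :=
      { toFun := fun p => (c (f (c.symm (p, i₀)))).1
        invFun := fun p => (c (f.symm (c.symm (p, i₀)))).1
        left_inv := fun p => by
          beta_reduce
          rw [hf' _ (f (c.symm (p, i₀))) (by simp)]
          simp
        right_inv := fun p => by
          beta_reduce
          rw [hf _ (f.symm (c.symm (p, i₀))) (by simp)]
          simp }
    have he : ∀ v, (c (f v)).1 = e (c v).1 := fun v => hf _ _ (by simp)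
    obtain ⟨g, hg⟩ := hAut e fun p q => by
      have := f.map_adj_iff (v := c.symm (p, i₀)) (w := c.symm (q, i₀))
      rw [hadj, hadj, he, he] at this
      simpa using this
    have hfc : ∀ p i, (c (f (c.symm (p, i)))).1 = g • p := fun p i => by
      rw [he, ← hg, Equiv.apply_symm_apply]
    have hfc' : ∀ p i, (c (f.symm (c.symm (p, i)))).1 = g⁻¹ • p := fun p i => by
      rw [eq_inv_smul_iff, ← hg, ← he]
      simp
    -- `F q` records f from the fibre over g⁻¹ • q to that over q.
    let F : P → Equiv.Perm M := fun q =>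
      { toFun := fun i => (c (f (c.symm (g⁻¹ • q, i)))).2
        invFun := fun i => (c (f.symm (c.symm (q, i)))).2
        left_inv := fun i => by
          have : (q, (c (f (c.symm (g⁻¹ • q, i)))).2) = c (f (c.symm (g⁻¹ • q, i))) :=
            Prod.ext (by rw [hfc, smul_inv_smul]) rfl
          beta_reduce
          rw [this]
          simp
        right_inv := fun i => by
          have : (g⁻¹ • q, (c (f.symm (c.symm (q, i)))).2) = c (f.symm (c.symm (q, i))) :=
            Prod.ext (by rw [hfc']) rfl
          beta_reduce
          rw [this]
          simp }
    refine ⟨⟨F, g⟩, RelIso.ext fun v => ?_⟩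
    obtain ⟨⟨p, i⟩, rfl⟩ := c.symm.surjective v
    apply c.injective
    refine Prod.ext ?_ ?_
    · rw [hfc]
      simp [wreathIso, Equiv.permCongr_apply, wreathPerm_apply]
    · simp [wreathIso, Equiv.permCongr_apply, wreathPerm_apply, F]

end BlowUp

/-! ### Flags as a blow-up of the t-subsets -/

section Flags

variable {n : ℕ} {T : Finset ℕ} {t : ℕ} {f g : Finset (Finset (Fin n))} {A B : Finset (Fin n)}

theorem exists_mem_card_of_mem_flags (hf : f ∈ flags n T) (ht : t ∈ T) : ∃ A ∈ f, #A = t := by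
  rw [← hf.2] at ht
  exact mem_image.1 ht

theorem card_mem_of_mem_flags (hf : f ∈ flags n T) (hA : A ∈ f) : #A ∈ T :=
  hf.2 ▸ mem_image_of_mem _ hA

theorem subset_of_mem_flags (hf : f ∈ flags n T) (hA : A ∈ f) (hB : B ∈ f) (h : #A ≤ #B) :
    A ⊆ B := by
  rcases hf.1.2 A hA B hB with h1 | h1
  exacts [h1, (eq_of_subset_of_card_le h1 h).symm.subset]

theorem generalPosition_iff_union_eq_univ (ht : IsLeast (T : Set ℕ) t) (hn : n ≤ 2 * t)
    (hf : f ∈ flags n T) (hg : g ∈ flags n T) (hA : A ∈ f) (hB : B ∈ g) (hAt : #A = t)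
    (hBt : #B = t) : GeneralPosition f g ↔ A ∪ B = univ := by
  constructor
  · intro h
    rcases h A hA B hB with h | h
    · have := card_union_of_disjoint (disjoint_iff_inter_eq_empty.2 h)
      exact eq_univ_of_card _ (le_antisymm (card_le_univ _) (by rw [Fintype.card_fin]; omega))
    · exact h
  · intro h C hC D hD
    have hAC := subset_of_mem_flags hf hA hC (hAt.trans_le (ht.2 (card_mem_of_mem_flags hf hC)))
    have hBD := subset_of_mem_flags hg hB hD (hBt.trans_le (ht.2 (card_mem_of_mem_flags hg hD)))
    exact .inr (univ_subset_iff.1 (h ▸ union_subset_union hAC hBD))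

/-- The member of cardinality `t` of a flag whose type contains `t`. -/
noncomputable def flagMember (ht : t ∈ T) (f : flags n T) : Set.powersetCard (Fin n) t :=
  Set.powersetCard.ofCard (exists_mem_card_of_mem_flags f.2 ht).choose_spec.2

theorem flagMember_mem (ht : t ∈ T) (f : flags n T) :
    (flagMember ht f : Finset (Fin n)) ∈ f.1 :=
  (exists_mem_card_of_mem_flags f.2 ht).choose_spec.1

theorem flagMember_eq_iff (ht : t ∈ T) (f : flags n T) (p : Set.powersetCard (Fin n) t) :
    flagMember ht f = p ↔ (p : Finset (Fin n)) ∈ f.1 := by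
  refine ⟨fun h => h ▸ flagMember_mem ht f, fun h => Set.powersetCard.eq_iff_subset.2 ?_⟩
  refine subset_of_mem_flags f.2 (flagMember_mem ht f) h ?_
  rw [Set.powersetCard.card_eq, Set.powersetCard.card_eq]

theorem generalPositionGraph_adj_iff (ht : IsLeast (T : Set ℕ) t) (hn : n ≤ 2 * t)
    (f g : flags n T) : (generalPositionGraph n T).Adj f g ↔
      (flagMember ht.1 f : Finset (Fin n)) ∪ flagMember ht.1 g = univ := by
  have h := generalPosition_iff_union_eq_univ ht hn f.2 g.2 (flagMember_mem ht.1 f)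
    (flagMember_mem ht.1 g) (Set.powersetCard.card_eq _) (Set.powersetCard.card_eq _)
  refine ⟨fun hfg => h.1 hfg.2, fun hfg => ⟨?_, h.2 hfg⟩⟩
  rintro rfl
  rw [union_self] at hfg
  exact (f.2.1.1 _ (flagMember_mem ht.1 f)).2 hfg

theorem smul_mem_flagsThrough (σ : Equiv.Perm (Fin n)) (hf : f ∈ flagsThrough n T A) :
    σ • f ∈ flagsThrough n T (σ • A) := by
  refine ⟨⟨⟨?_, ?_⟩, ?_⟩, smul_mem_smul_finset hf.2⟩
  · intro B hB
    obtain ⟨C, hC, rfl⟩ := mem_smul_finset.1 hB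
    have := hf.1.1.1 C hC
    refine ⟨by simpa using this.1, fun h => this.2 ?_⟩
    rw [← card_eq_iff_eq_univ, ← card_smul_finset σ, h, card_univ]
  · intro B hB C hC
    obtain ⟨B', hB', rfl⟩ := mem_smul_finset.1 hB
    obtain ⟨C', hC', rfl⟩ := mem_smul_finset.1 hC
    simpa only [smul_finset_subset_smul_finset_iff] using hf.1.1.2 B' hB' C' hC'
  · rw [← hf.1.2]
    ext s
    simp [flagType, mem_smul_finset]

theorem ncard_flagsThrough_eq (h : #A = #B) :
    (flagsThrough n T A).ncard = (flagsThrough n T B).ncard := by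
  have key : ∀ (σ : Equiv.Perm (Fin n)) (A : Finset (Fin n)),
      (flagsThrough n T A).ncard ≤ (flagsThrough n T (σ • A)).ncard := fun σ A =>
    Set.ncard_le_ncard_of_injOn (σ • ·) (fun f hf => smul_mem_flagsThrough σ hf)
      (MulAction.injective σ).injOn (Set.toFinite _)
  obtain ⟨σ, hσ⟩ := (Set.powersetCard.isPretransitive (α := Fin n) (n := #B)).exists_smul_eq
    (Set.powersetCard.ofCard h) (Set.powersetCard.ofCard rfl)
  have hσ' : σ • A = B := congrArg Subtype.val hσ
  refine le_antisymm (hσ' ▸ key σ A) ?_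
  have := key σ⁻¹ B
  rwa [← hσ', inv_smul_smul, hσ'] at this

theorem ncard_flagsThrough_pos (hT : T ⊆ Icc 1 (n - 1)) (hA : #A ∈ T) :
    0 < (flagsThrough n T A).ncard := by
  -- Initial segments with sizes in T form a flag.
  let I : ℕ → Finset (Fin n) := fun s => univ.filter fun i => i.val < s
  have hmono : ∀ {a b}, a ≤ b → I a ⊆ I b := fun hab i hi => by
    simp only [I, mem_filter, mem_univ, true_and] at hi ⊢
    omega
  have hI : ∀ s ∈ T, #(I s) = s ∧ 1 ≤ s ∧ s < n := fun s hs => by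
    have := mem_Icc.1 (hT hs)
    refine ⟨?_, by omega, by omega⟩
    simp only [I, Fin.card_filter_val_lt]
    omega
  rw [ncard_flagsThrough_eq (hI _ hA).1.symm, Set.ncard_pos (Set.toFinite _)]
  refine ⟨T.image I, ⟨⟨?_, ?_⟩, ?_⟩, mem_image_of_mem _ hA⟩
  · intro B hB
    obtain ⟨s, hs, rfl⟩ := mem_image.1 hB
    obtain ⟨h1, h2, h3⟩ := hI s hs
    constructor
    · rw [← card_pos.trans nonempty_iff_ne_empty]
      omega
    · intro h
      rw [h, card_univ, Fintype.card_fin] at h1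
      omega
  · intro B hB C hC
    obtain ⟨s, hs, rfl⟩ := mem_image.1 hB
    obtain ⟨r, hr, rfl⟩ := mem_image.1 hC
    exact (le_total s r).imp hmono hmono
  · rw [flagType, image_image]
    exact (image_congr fun s hs => (hI s hs).1).trans image_id

/-- The flags with a prescribed `t`-subset among their members. -/
noncomputable def flagMemberFiberEquiv (ht : t ∈ T) (p : Set.powersetCard (Fin n) t) :
    {f : flags n T // flagMember ht f = p} ≃ flagsThrough n T p where
  toFun f := ⟨f.1.1, f.1.2, (flagMember_eq_iff ht f.1 p).1 f.2⟩
  invFun f := ⟨⟨f.1, f.2.1⟩, (flagMember_eq_iff ht _ p).2 f.2.2⟩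
  left_inv _ := rfl
  right_inv _ := rfl

theorem exists_flags_equiv (ht : t ∈ T) (hA : #A = t) :
    ∃ c : flags n T ≃ Set.powersetCard (Fin n) t × Fin (flagsThrough n T A).ncard,
      ∀ f, (c f).1 = flagMember ht f := by
  have hcard : ∀ p : Set.powersetCard (Fin n) t,
      Nat.card {f : flags n T // flagMember ht f = p} = (flagsThrough n T A).ncard := fun p => by
    rw [Nat.card_congr (flagMemberFiberEquiv ht p), Nat.card_coe_set_eq]
    exact ncard_flagsThrough_eq ((Set.powersetCard.card_eq p).trans hA.symm)
  exact ⟨(Equiv.sigmaFiberEquiv (flagMember ht)).symm.trans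
    ((Equiv.sigmaCongrRight fun p => Finite.equivFinOfCardEq (hcard p)).trans
      (Equiv.sigmaEquivProd _ _)), fun f => rfl⟩

end Flags

end FlagGraph

theorem corollary4p3 (n : ℕ) (T : Finset ℕ) (hT : T ⊆ Finset.Icc 1 (n - 1))
    (t₁ : ℕ) (ht₁ : IsLeast (T : Set ℕ) t₁)
    (hn : (n : ℚ) / 2 ≤ t₁) (hmid : (n : ℚ) / 2 = t₁ → n = 2)
    (A : Finset (Fin n)) (hA : A.card = t₁) :
    Nonempty ((FlagGraph.generalPositionGraph n T ≃g FlagGraph.generalPositionGraph n T) ≃*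
      FlagGraph.SubsetWreathProduct (FlagGraph.flagsThrough n T A).ncard n t₁) := by
  have hmem := Finset.mem_Icc.1 (hT ht₁.1)
  have hn2 : n ≤ 2 * t₁ := by
    have : (n : ℚ) ≤ 2 * t₁ := by linarith
    exact_mod_cast this
  have hlt : n < 2 * t₁ ∨ t₁ + 1 = n := by
    rcases hn2.lt_or_eq with h | h
    · exact .inl h
    -- The surviving middle case is n = 2, t = 1, where complements are singletons.
    · have : n = 2 := hmid (by rw [h]; push_cast; ring)
      omega
  obtain ⟨c, hc⟩ := FlagGraph.exists_flags_equiv ht₁.1 hA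
  have : Nonempty (Fin (FlagGraph.flagsThrough n T A).ncard) :=
    ⟨⟨0, FlagGraph.ncard_flagsThrough_pos hT (hA ▸ ht₁.1)⟩⟩
  have : FaithfulSMul (Equiv.Perm (Fin n)) (Set.powersetCard (Fin n) t₁) :=
    Set.powersetCard.faithfulSMul hmem.1 (by
      rw [ENat.card_eq_coe_fintype_card, Fintype.card_fin]
      exact_mod_cast (by omega : t₁ < n))
  refine FlagGraph.nonempty_blowUp_mulEquiv
    (R := fun p q : Set.powersetCard (Fin n) t₁ => (p : Finset (Fin n)) ∪ q = Finset.univ) c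
    (fun f g => ?_) (fun σ p q => ?_) (fun p q h => ?_) (fun e he => ?_)
  · rw [hc, hc, FlagGraph.generalPositionGraph_adj_iff ht₁ hn2]
  · rw [Set.powersetCard.coe_smul, Set.powersetCard.coe_smul, ← Finset.smul_finset_union,
      smul_eq_iff_eq_inv_smul, Finset.smul_finset_univ]
  · exact FlagGraph.eq_of_union_eq_univ_iff (by simpa using hn2) (by rw [Fintype.card_fin]; omega) h
  · exact FlagGraph.exists_perm_of_union_eq_univ_iff (by rw [Fintype.card_fin]; omega)
      (by simpa using hlt) e he
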